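/- Let $d\in\mathbb N$, let $|\cdot|$ be the Euclidean norm on $\mathbb R^d$, and let $\mathcal P_2(\mathbb R^d)$ be the set of Borel probability measures $\mu$ on $\mathbb R^d$ with $\int |x|^2\,\mu(dx)<\infty$. For $\mu,\nu\in\mathcal P_2(\mathbb R^d)$ let $\Pi(\mu,\nu)$ be the set of probability measures on $\mathbb R^d\times\mathbb R^d$ with first marginal $\mu$ and second marginal $\nu$, and put $$\mathcal W_2^2(\mu,\nu):=\inf_{\pi\in\Pi(\mu,\nu)}\int |x-y|^2\,\pi(dx,dy).$$ **Theorem.** Let $\mu,\nu\in\mathcal P_2(\mathbb R^d)$. Then the following are equivalent: (i) $\mu\le_c\nu$ in the convex order, that is, $\int f(x)\,\mu(dx)\le\int f(x)\,\nu(dx)$ for all convex $f\colon\mathbb R^d\to\mathbb R$, where the integrals are well defined with values in $(-\infty,+\infty]$; (ii) $\mathcal W_2^2(\nu,\rho)-\mathcal W_2^2(\mu,\rho)\le\int|x|^2\,\nu(dx)-\int|x|^2\,\mu(dx)$ for all $\rho\in\mathcal P_2(\mathbb R^d)$. -/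

import Mathlib

open MeasureTheory

namespace ConvexOrderW2

/-- `μ ∈ 𝒫₂(ℝᵈ)`: a Borel probability measure on Euclidean space with finite second moment. -/
def MemP2 {d : ℕ} (μ : Measure (EuclideanSpace ℝ (Fin d))) : Prop :=
  IsProbabilityMeasure μ ∧ ∫⁻ x, ‖x‖ₑ ^ 2 ∂μ < ⊤

/-- The set `Π(μ, ν)` of probability measures on `ℝᵈ × ℝᵈ` with marginals `μ` and `ν`. -/
def couplings {d : ℕ} (μ ν : Measure (EuclideanSpace ℝ (Fin d))) :
    Set (Measure (EuclideanSpace ℝ (Fin d) × EuclideanSpace ℝ (Fin d))) :=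
  {π | IsProbabilityMeasure π ∧ π.map Prod.fst = μ ∧ π.map Prod.snd = ν}

/-- The squared Wasserstein-2 distance as an extended nonnegative number:
the infimum over all couplings of the integral of `|x - y| ^ 2`. -/
noncomputable def eW2sq {d : ℕ} (μ ν : Measure (EuclideanSpace ℝ (Fin d))) : ENNReal :=
  ⨅ π ∈ couplings μ ν, ∫⁻ z, ‖z.1 - z.2‖ₑ ^ 2 ∂π

/-- The squared Wasserstein-2 distance as a real number. On `𝒫₂(ℝᵈ)` no information is lost,
see `eW2sq_lt_top`. -/
noncomputable def W2sq {d : ℕ} (μ ν : Measure (EuclideanSpace ℝ (Fin d))) : ℝ :=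
  (eW2sq μ ν).toReal

/-- The squared Wasserstein-2 distance is finite on `𝒫₂(ℝᵈ)`. -/
theorem eW2sq_lt_top {d : ℕ} {μ ν : Measure (EuclideanSpace ℝ (Fin d))}
    (hμ : MemP2 μ) (hν : MemP2 ν) : eW2sq μ ν < ⊤ := by
  obtain ⟨hμp, hμ2⟩ := hμ
  obtain ⟨hνp, hν2⟩ := hν
  have hmem : μ.prod ν ∈ couplings μ ν := by
    refine ⟨inferInstance, ?_, ?_⟩
    · simp [Measure.map_fst_prod]
    · simp [Measure.map_snd_prod]
  refine lt_of_le_of_lt (iInf₂_le _ hmem) ?_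
  have hm : MemLp (fun x : EuclideanSpace ℝ (Fin d) => x) 2 μ := by
    refine ⟨aestronglyMeasurable_id, ?_⟩
    rw [eLpNorm_lt_top_iff_lintegral_rpow_enorm_lt_top (by simp) (by simp)]
    simpa using hμ2
  have hn : MemLp (fun x : EuclideanSpace ℝ (Fin d) => x) 2 ν := by
    refine ⟨aestronglyMeasurable_id, ?_⟩
    rw [eLpNorm_lt_top_iff_lintegral_rpow_enorm_lt_top (by simp) (by simp)]
    simpa using hν2
  have h := (hm.comp_fst ν).sub (hn.comp_snd μ)
  have h2 := h.2
  rw [eLpNorm_lt_top_iff_lintegral_rpow_enorm_lt_top (by simp) (by simp)] at h2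
  simpa using h2

/-- The integral of a real function as an extended real number, positive part minus negative part.
A convex function on `ℝᵈ` has an affine minorant, so that its negative part has a finite integral
against any measure in `𝒫₂(ℝᵈ)`; its integral is then well defined with values in `(-∞, +∞]`. -/
noncomputable def eIntegral {d : ℕ} (f : EuclideanSpace ℝ (Fin d) → ℝ)
    (μ : Measure (EuclideanSpace ℝ (Fin d))) : EReal :=
  ((∫⁻ x, ENNReal.ofReal (f x) ∂μ : ENNReal) : EReal)
    - ((∫⁻ x, ENNReal.ofReal (-f x) ∂μ : ENNReal) : EReal)

/-- The convex order: `∫ f dμ ≤ ∫ f dν` for all convex `f : ℝᵈ → ℝ`, where the integrals may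
take the value `+∞`. -/
def ConvexOrderLE {d : ℕ} (μ ν : Measure (EuclideanSpace ℝ (Fin d))) : Prop :=
  ∀ f : EuclideanSpace ℝ (Fin d) → ℝ, ConvexOn ℝ Set.univ f → eIntegral f μ ≤ eIntegral f ν

end ConvexOrderW2

namespace ConvexOrderW2

/-! Expanding the square, (ii) says that the maximal correlation `∫ ⟪x, z⟫ dπ` over couplings with
`ρ` does not decrease when `μ` is replaced by `ν`.

(i) ⇒ (ii): replace `ρ` by finitely many atoms `y i` of masses `p i`. A coupling of `ν` with the
atoms is a partition of unity `w` with `∫ w i dν = p i`. The attainable pairs (masses, correlation)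
form a convex set whose support function at `(a, b)` is `∫ max_i (a i + ⟪b • y i, x⟫) dν`. The pair
coming from a coupling of `μ` is bounded by the same integral against `μ`, so convex order and
Hahn–Banach put it in the closure (`mem_closure_partitionMoments`). A small perturbation restores
the exact masses, and gluing gives a coupling with `ρ` itself
(`exists_coupling_of_mem_partitionMoments`).

(ii) ⇒ (i): for a max-affine `f`, test with the law `ρ` under `μ` of a subgradient of `f`.
Fenchel–Young is an equality along the subgradient coupling and an inequality for every coupling of
`ν` with `ρ` (`integral_maxAffine_le_of_W2sq_sub_le`). General convex functions are increasing
limits of max-affine ones. -/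

theorem MemP2.memLp_id {d : ℕ} {μ : Measure (EuclideanSpace ℝ (Fin d))} (hμ : MemP2 μ) :
    MemLp (fun x => x) 2 μ := by
  refine ⟨aestronglyMeasurable_id, ?_⟩
  rw [eLpNorm_lt_top_iff_lintegral_rpow_enorm_lt_top (by simp) (by simp)]
  simpa using hμ.2

theorem MemP2.integrable_norm_sq {d : ℕ} {μ : Measure (EuclideanSpace ℝ (Fin d))}
    (hμ : MemP2 μ) : Integrable (fun x => ‖x‖ ^ 2) μ :=
  hμ.memLp_id.integrable_norm_pow two_ne_zero

theorem MemP2.integrable_id {d : ℕ} {μ : Measure (EuclideanSpace ℝ (Fin d))}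
    (hμ : MemP2 μ) : Integrable (fun x => x) μ := by
  have := hμ.1
  exact hμ.memLp_id.integrable one_le_two

/-! ### Transport cost expressed through correlation. -/

section Couplings

variable {d : ℕ} {μ ν : Measure (EuclideanSpace ℝ (Fin d))}
  {π : Measure (EuclideanSpace ℝ (Fin d) × EuclideanSpace ℝ (Fin d))}

theorem integral_fst_of_mem_couplings (hπ : π ∈ couplings μ ν)
    {f : EuclideanSpace ℝ (Fin d) → ℝ} (hf : AEStronglyMeasurable f μ) :
    ∫ z, f z.1 ∂π = ∫ x, f x ∂μ := by
  rw [← hπ.2.1] at hf ⊢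
  rw [integral_map measurable_fst.aemeasurable hf]

theorem integral_snd_of_mem_couplings (hπ : π ∈ couplings μ ν)
    {f : EuclideanSpace ℝ (Fin d) → ℝ} (hf : AEStronglyMeasurable f ν) :
    ∫ z, f z.2 ∂π = ∫ x, f x ∂ν := by
  rw [← hπ.2.2] at hf ⊢
  rw [integral_map measurable_snd.aemeasurable hf]

theorem measurePreserving_fst_of_mem_couplings (hπ : π ∈ couplings μ ν) :
    MeasurePreserving Prod.fst π μ := ⟨measurable_fst, hπ.2.1⟩

theorem measurePreserving_snd_of_mem_couplings (hπ : π ∈ couplings μ ν) :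
    MeasurePreserving Prod.snd π ν := ⟨measurable_snd, hπ.2.2⟩

theorem memLp_fst_of_mem_couplings (hμ : MemP2 μ) (hπ : π ∈ couplings μ ν) :
    MemLp Prod.fst 2 π :=
  hμ.memLp_id.comp_measurePreserving (measurePreserving_fst_of_mem_couplings hπ)

theorem memLp_snd_of_mem_couplings (hν : MemP2 ν) (hπ : π ∈ couplings μ ν) :
    MemLp Prod.snd 2 π :=
  hν.memLp_id.comp_measurePreserving (measurePreserving_snd_of_mem_couplings hπ)

theorem integrable_inner_of_memLp_two {α E : Type*} [MeasurableSpace α] [NormedAddCommGroup E]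
    [InnerProductSpace ℝ E] {m : Measure α} {f g : α → E} (hf : MemLp f 2 m) (hg : MemLp g 2 m) :
    Integrable (fun z => inner ℝ (f z) (g z)) m := by
  refine (hf.norm.integrable_mul hg.norm).mono' (hf.1.inner hg.1) (.of_forall fun z => ?_)
  exact norm_inner_le_norm _ _

theorem integral_norm_sub_sq_eq (hμ : MemP2 μ) (hν : MemP2 ν) (hπ : π ∈ couplings μ ν) :
    ∫ z, ‖z.1 - z.2‖ ^ 2 ∂π =
      (∫ x, ‖x‖ ^ 2 ∂μ) + (∫ x, ‖x‖ ^ 2 ∂ν) - 2 * ∫ z, inner ℝ z.1 z.2 ∂π := by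
  have h1 := memLp_fst_of_mem_couplings hμ hπ
  have h2 := memLp_snd_of_mem_couplings hν hπ
  have i1 := h1.integrable_norm_pow two_ne_zero
  have i2 := h2.integrable_norm_pow two_ne_zero
  have i3 := integrable_inner_of_memLp_two h1 h2
  rw [← integral_fst_of_mem_couplings hπ (f := fun x => ‖x‖ ^ 2) hμ.integrable_norm_sq.1,
    ← integral_snd_of_mem_couplings hπ (f := fun x => ‖x‖ ^ 2) hν.integrable_norm_sq.1,
    ← integral_const_mul, ← integral_add i1 i2]
  refine (integral_congr_ae (.of_forall fun z => ?_)).trans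
    (integral_sub (i1.add i2) (i3.const_mul 2))
  simp only [norm_sub_sq_real]
  ring

theorem lintegral_cost_eq (hμ : MemP2 μ) (hν : MemP2 ν) (hπ : π ∈ couplings μ ν) :
    ∫⁻ z, ‖z.1 - z.2‖ₑ ^ 2 ∂π =
      ENNReal.ofReal ((∫ x, ‖x‖ ^ 2 ∂μ) + (∫ x, ‖x‖ ^ 2 ∂ν) - 2 * ∫ z, inner ℝ z.1 z.2 ∂π) := by
  have : ∀ z : EuclideanSpace ℝ (Fin d) × EuclideanSpace ℝ (Fin d),
      ‖z.1 - z.2‖ₑ ^ 2 = ENNReal.ofReal (‖z.1 - z.2‖ ^ 2) := fun z => by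
    rw [ENNReal.ofReal_pow (norm_nonneg _), ofReal_norm]
  simp_rw [this]
  have i : Integrable (fun z => ‖z.1 - z.2‖ ^ 2) π :=
    ((memLp_fst_of_mem_couplings hμ hπ).sub
      (memLp_snd_of_mem_couplings hν hπ)).integrable_norm_pow two_ne_zero
  rw [← ofReal_integral_eq_lintegral_ofReal i (.of_forall fun z => by positivity),
    integral_norm_sub_sq_eq hμ hν hπ]

theorem cost_nonneg (hμ : MemP2 μ) (hν : MemP2 ν) (hπ : π ∈ couplings μ ν) :
    0 ≤ (∫ x, ‖x‖ ^ 2 ∂μ) + (∫ x, ‖x‖ ^ 2 ∂ν) - 2 * ∫ z, inner ℝ z.1 z.2 ∂π := by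
  rw [← integral_norm_sub_sq_eq hμ hν hπ]
  positivity

theorem W2sq_le (hμ : MemP2 μ) (hν : MemP2 ν) (hπ : π ∈ couplings μ ν) :
    W2sq μ ν ≤ (∫ x, ‖x‖ ^ 2 ∂μ) + (∫ x, ‖x‖ ^ 2 ∂ν) - 2 * ∫ z, inner ℝ z.1 z.2 ∂π := by
  refine ENNReal.toReal_le_of_le_ofReal (cost_nonneg hμ hν hπ) ?_
  rw [← lintegral_cost_eq hμ hν hπ]
  exact iInf₂_le π hπ

theorem le_W2sq (hμ : MemP2 μ) (hν : MemP2 ν) {c : ℝ}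
    (h : ∀ π ∈ couplings μ ν,
      c ≤ (∫ x, ‖x‖ ^ 2 ∂μ) + (∫ x, ‖x‖ ^ 2 ∂ν) - 2 * ∫ z, inner ℝ z.1 z.2 ∂π) :
    c ≤ W2sq μ ν := by
  refine (ENNReal.ofReal_le_iff_le_toReal (eW2sq_lt_top hμ hν).ne).1 (le_iInf₂ fun π hπ => ?_)
  rw [lintegral_cost_eq hμ hν hπ]
  exact ENNReal.ofReal_le_ofReal (h π hπ)

/-- The second moment of `ρ` cancels in the difference, so only the correlations remain to be
compared. -/
theorem W2sq_sub_le_of_forall_exists_coupling {ρ : Measure (EuclideanSpace ℝ (Fin d))}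
    (hμ : MemP2 μ) (hν : MemP2 ν) (hρ : MemP2 ρ)
    (h : ∀ π ∈ couplings μ ρ, ∀ ε > 0, ∃ π' ∈ couplings ν ρ,
      ∫ z, inner ℝ z.1 z.2 ∂π - ε ≤ ∫ z, inner ℝ z.1 z.2 ∂π') :
    W2sq ν ρ - W2sq μ ρ ≤ (∫ x, ‖x‖ ^ 2 ∂ν) - ∫ x, ‖x‖ ^ 2 ∂μ := by
  suffices W2sq ν ρ - ((∫ x, ‖x‖ ^ 2 ∂ν) - ∫ x, ‖x‖ ^ 2 ∂μ) ≤ W2sq μ ρ by linarith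
  refine le_W2sq hμ hρ fun π hπ => le_of_forall_pos_le_add fun ε hε => ?_
  -- Half of `ε`, since the correlation enters the cost with factor 2.
  obtain ⟨π', hπ', h'⟩ := h π hπ (ε / 2) (by positivity)
  linarith [W2sq_le hν hρ hπ']

end Couplings

/-! ### Max-affine functions and measurable selection. -/

theorem exists_measurable_argmax {α ι : Type*} [MeasurableSpace α] [Finite ι] [Nonempty ι]
    [MeasurableSpace ι] [MeasurableSingletonClass ι] {h : ι → α → ℝ}
    (hh : ∀ i, Measurable (h i)) :
    ∃ J : α → ι, Measurable J ∧ ∀ i x, h i x ≤ h (J x) x := by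
  classical
  have := Fintype.ofFinite ι
  suffices ∀ s : Finset ι, ∃ J : α → ι, Measurable J ∧ ∀ i ∈ s, ∀ x, h i x ≤ h (J x) x by
    obtain ⟨J, hJ, hs⟩ := this Finset.univ
    exact ⟨J, hJ, fun i => hs i (Finset.mem_univ i)⟩
  intro s
  induction s using Finset.induction_on with
  | empty => exact ⟨fun _ => Classical.arbitrary ι, measurable_const, by simp⟩
  | insert a s _ ih =>
    obtain ⟨J, hJ, hs⟩ := ih
    have hm : Measurable fun x => h (J x) x :=
      (measurable_from_prod_countable_left (f := fun z : α × ι => h z.2 z.1) hh).comp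
        (measurable_id.prodMk hJ)
    refine ⟨fun x => if h (J x) x ≤ h a x then a else J x,
      Measurable.ite (measurableSet_le hm (hh a)) measurable_const hJ, fun i hi x => ?_⟩
    rcases Finset.mem_insert.1 hi with rfl | hi
    · dsimp only
      split_ifs with hc
      · exact le_rfl
      · exact (not_le.1 hc).le
    · dsimp only
      split_ifs with hc
      · exact (hs i hi x).trans hc
      · exact hs i hi x

theorem integrable_comp_of_finite {ι α : Type*} [Finite ι] [MeasurableSpace ι]
    [MeasurableSingletonClass ι] [MeasurableSpace α] {m : Measure α} [IsFiniteMeasure m]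
    (a : ι → ℝ) {J : α → ι} (hJ : Measurable J) : Integrable (fun x => a (J x)) m := by
  have := Fintype.ofFinite ι
  refine Integrable.of_bound (C := ∑ i, ‖a i‖) ?_ (.of_forall fun z => ?_)
  · exact ((measurable_of_countable a).comp hJ).aestronglyMeasurable
  · exact Finset.single_le_sum (f := fun i => ‖a i‖) (fun i _ => norm_nonneg _)
      (Finset.mem_univ _)

/-- The maximum of the affine functions `x ↦ c i + ⟪y i, x⟫`. -/
noncomputable def maxAffine {d : ℕ} {ι : Type*} [Fintype ι] [Nonempty ι] (c : ι → ℝ)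
    (y : ι → EuclideanSpace ℝ (Fin d)) : EuclideanSpace ℝ (Fin d) → ℝ :=
  Finset.univ.sup' Finset.univ_nonempty fun i x => c i + inner ℝ (y i) x

section MaxAffine

variable {d : ℕ} {ι : Type*} [Fintype ι] [Nonempty ι] {c : ι → ℝ}
  {y : ι → EuclideanSpace ℝ (Fin d)} {μ : Measure (EuclideanSpace ℝ (Fin d))}

theorem le_maxAffine (c : ι → ℝ) (y : ι → EuclideanSpace ℝ (Fin d)) (i : ι)
    (x : EuclideanSpace ℝ (Fin d)) : c i + inner ℝ (y i) x ≤ maxAffine c y x := by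
  rw [maxAffine, Finset.sup'_apply]
  exact Finset.le_sup' (fun i => c i + inner ℝ (y i) x) (Finset.mem_univ i)

theorem maxAffine_le {x : EuclideanSpace ℝ (Fin d)} {t : ℝ}
    (h : ∀ i, c i + inner ℝ (y i) x ≤ t) : maxAffine c y x ≤ t := by
  rw [maxAffine, Finset.sup'_apply]
  exact Finset.sup'_le _ _ fun i _ => h i

theorem convexOn_maxAffine : ConvexOn ℝ Set.univ (maxAffine c y) := by
  refine Finset.sup'_induction _ _ (fun f hf g hg => hf.sup hg) fun i _ => ?_
  exact (convexOn_const (c i) convex_univ).add ((innerₛₗ ℝ (y i)).convexOn convex_univ)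

theorem integrable_maxAffine (hμ : MemP2 μ) : Integrable (maxAffine c y) μ := by
  have := hμ.1
  refine Finset.sup'_induction (p := fun f => Integrable f μ) _ _
    (fun f hf g hg => hf.sup hg) fun i _ => ?_
  exact (integrable_const (c i)).add (hμ.integrable_id.const_inner (y i))

theorem measurable_maxAffine : Measurable (maxAffine c y) := by
  refine Finset.sup'_induction (p := fun f => Measurable f) _ _
    (fun f hf g hg => hf.sup hg) fun i _ => ?_
  fun_prop

theorem exists_measurable_argmax_maxAffine [MeasurableSpace ι] [MeasurableSingletonClass ι]
    (c : ι → ℝ) (y : ι → EuclideanSpace ℝ (Fin d)) :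
    ∃ J : EuclideanSpace ℝ (Fin d) → ι, Measurable J ∧
      ∀ x, maxAffine c y x = c (J x) + inner ℝ (y (J x)) x := by
  obtain ⟨J, hJ, h⟩ := exists_measurable_argmax
    (h := fun i (x : EuclideanSpace ℝ (Fin d)) => c i + inner ℝ (y i) x) (fun i => by fun_prop)
  exact ⟨J, hJ, fun x => le_antisymm (maxAffine_le fun i => h i x) (le_maxAffine c y _ x)⟩

end MaxAffine

theorem eIntegral_eq_integral {d : ℕ} {μ : Measure (EuclideanSpace ℝ (Fin d))}
    {f : EuclideanSpace ℝ (Fin d) → ℝ} (hf : Integrable f μ) :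
    eIntegral f μ = ((∫ x, f x ∂μ : ℝ) : EReal) := by
  have hn : ∫⁻ x, ENNReal.ofReal (-f x) ∂μ < ⊤ := hf.neg.lintegral_lt_top
  rw [integral_eq_lintegral_pos_part_sub_lintegral_neg_part hf, eIntegral, EReal.coe_sub,
    EReal.coe_ennreal_toReal hf.lintegral_lt_top.ne,
    EReal.coe_ennreal_toReal hn.ne]

/-! ### Moments of measurable partitions of unity. -/

section Partition

variable {d : ℕ} {ι : Type*} [Fintype ι] {ν : Measure (EuclideanSpace ℝ (Fin d))}
  {w : EuclideanSpace ℝ (Fin d) → ι → ℝ} {y : ι → EuclideanSpace ℝ (Fin d)}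

theorem integrable_partition [IsFiniteMeasure ν] (hw : Measurable w)
    (hs : ∀ x, w x ∈ stdSimplex ℝ ι) (i : ι) : Integrable (fun x => w x i) ν := by
  refine Integrable.of_bound (C := 1) (by fun_prop) (.of_forall fun x => ?_)
  rw [Real.norm_of_nonneg ((hs x).1 i), ← (hs x).2]
  exact Finset.single_le_sum (fun j _ => (hs x).1 j) (Finset.mem_univ i)

theorem integrable_partition_mul_inner (hν : MemP2 ν) (hw : Measurable w)
    (hs : ∀ x, w x ∈ stdSimplex ℝ ι) (y : EuclideanSpace ℝ (Fin d)) (i : ι) :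
    Integrable (fun x => w x i * inner ℝ y x) ν := by
  refine (hν.integrable_id.const_inner (𝕜 := ℝ) y).bdd_mul (c := 1) (by fun_prop)
    (.of_forall fun x => ?_)
  rw [Real.norm_of_nonneg ((hs x).1 i), ← (hs x).2]
  exact Finset.single_le_sum (fun j _ => (hs x).1 j) (Finset.mem_univ i)

/-- The pairs formed by the masses of the pieces of a measurable partition of unity and by the
sum over the pieces of the integrals of `⟪y i, x⟫`. -/
def partitionMoments (ν : Measure (EuclideanSpace ℝ (Fin d))) (y : ι → EuclideanSpace ℝ (Fin d)) :
    Set ((ι → ℝ) × ℝ) :=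
  {q | ∃ w : EuclideanSpace ℝ (Fin d) → ι → ℝ, Measurable w ∧ (∀ x, w x ∈ stdSimplex ℝ ι) ∧
    (∀ i, ∫ x, w x i ∂ν = q.1 i) ∧ ∑ i, ∫ x, w x i * inner ℝ (y i) x ∂ν = q.2}

theorem convex_partitionMoments (hν : MemP2 ν) : Convex ℝ (partitionMoments ν y) := by
  have := hν.1
  rintro q ⟨w, hw, hs, hq, hv⟩ q' ⟨w', hw', hs', hq', hv'⟩ a b ha hb hab
  refine ⟨fun x => a • w x + b • w' x, by fun_prop,
    fun x => convex_stdSimplex ℝ ι (hs x) (hs' x) ha hb hab, fun i => ?_, ?_⟩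
  · have e := integral_add ((integrable_partition (ν := ν) hw hs i).const_mul a)
      ((integrable_partition (ν := ν) hw' hs' i).const_mul b)
    rw [integral_const_mul, integral_const_mul, hq, hq'] at e
    simpa using e
  · simp only [Prod.snd_add, Prod.smul_snd, ← hv, ← hv', smul_eq_mul, Finset.mul_sum,
      ← Finset.sum_add_distrib]
    refine Finset.sum_congr rfl fun i _ => ?_
    rw [← integral_const_mul, ← integral_const_mul, ← integral_add
      ((integrable_partition_mul_inner hν hw hs (y i) i).const_mul a)
      ((integrable_partition_mul_inner hν hw' hs' (y i) i).const_mul b)]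
    refine integral_congr_ae (.of_forall fun x => ?_)
    simp only [Pi.add_apply, Pi.smul_apply, smul_eq_mul]
    ring

theorem const_mem_partitionMoments (hν : MemP2 ν) {r : ι → ℝ} (hr : r ∈ stdSimplex ℝ ι) :
    (r, ∑ i, r i * ∫ x, inner ℝ (y i) x ∂ν) ∈ partitionMoments ν y := by
  have := hν.1
  exact ⟨fun _ => r, measurable_const, fun _ => hr, fun i => by simp,
    by simp [integral_const_mul]⟩

theorem fst_mem_stdSimplex_of_mem_partitionMoments (hν : MemP2 ν) {q : (ι → ℝ) × ℝ}
    (hq : q ∈ partitionMoments ν y) : q.1 ∈ stdSimplex ℝ ι := by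
  have := hν.1
  obtain ⟨w, hw, hs, hq, -⟩ := hq
  refine ⟨fun i => hq i ▸ integral_nonneg fun x => (hs x).1 i, ?_⟩
  simp_rw [← hq]
  rw [← integral_finsetSum _ fun i _ => integrable_partition hw hs i]
  simp [(hs _).2]

variable [Nonempty ι]

/-- This attains the support function: at each `x` the average of `a i + b * ⟪y i, x⟫` with weights
`w x` is largest when all weight sits on a maximizing index. -/
theorem exists_mem_partitionMoments_eq_integral_maxAffine (hν : MemP2 ν) (a : ι → ℝ) (b : ℝ) :
    ∃ q ∈ partitionMoments ν y,
      ∑ i, a i * q.1 i + b * q.2 = ∫ x, maxAffine a (fun i => b • y i) x ∂ν := by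
  classical
  have := hν.1
  let _ : MeasurableSpace ι := ⊤
  obtain ⟨J, hJ, hmax⟩ := exists_measurable_argmax_maxAffine a (fun i => b • y i)
  set w : EuclideanSpace ℝ (Fin d) → ι → ℝ := fun x => Pi.single (J x) 1 with hwdef
  have hw : Measurable w :=
    (measurable_of_countable fun j : ι => (Pi.single j 1 : ι → ℝ)).comp hJ
  have hs : ∀ x, w x ∈ stdSimplex ℝ ι := fun x => single_mem_stdSimplex ℝ (J x)
  refine ⟨(fun i => ∫ x, w x i ∂ν, ∑ i, ∫ x, w x i * inner ℝ (y i) x ∂ν),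
    ⟨w, hw, hs, fun _ => rfl, rfl⟩, ?_⟩
  simp only [Finset.mul_sum]
  rw [← Finset.sum_add_distrib]
  simp_rw [← integral_const_mul]
  have e : ∀ i, (∫ x, a i * w x i ∂ν) + ∫ x, b * (w x i * inner ℝ (y i) x) ∂ν =
      ∫ x, w x i * (a i + inner ℝ (b • y i) x) ∂ν := fun i => by
    rw [← integral_add ((integrable_partition hw hs i).const_mul _)
      ((integrable_partition_mul_inner hν hw hs (y i) i).const_mul b)]
    refine integral_congr_ae (.of_forall fun x => ?_)
    simp only [real_inner_smul_left]
    ring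
  simp_rw [e]
  rw [← integral_finsetSum]
  · refine integral_congr_ae (.of_forall fun x => ?_)
    simp [hmax x, hwdef, Pi.single_apply]
  · intro i _
    have := ((integrable_partition (ν := ν) hw hs i).mul_const (a i)).add
      (integrable_partition_mul_inner hν hw hs (b • y i) i)
    exact this.congr (.of_forall fun x => (mul_add _ _ _).symm)

/-- A functional strictly separating `(p, v)` from the closure has the form `(a, b)`; evaluated at
the maximizing partition for `(a, b)` it contradicts `h`. -/
theorem mem_closure_partitionMoments (hν : MemP2 ν) {p : ι → ℝ} {v : ℝ}
    (h : ∀ (a : ι → ℝ) (b : ℝ),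
      ∑ i, a i * p i + b * v ≤ ∫ x, maxAffine a (fun i => b • y i) x ∂ν) :
    (p, v) ∈ closure (partitionMoments ν y) := by
  classical
  by_contra hn
  obtain ⟨f, u, hf, hu⟩ := geometric_hahn_banach_closed_point
    (convex_partitionMoments hν).closure isClosed_closure hn
  have e : ∀ q : (ι → ℝ) × ℝ,
      f q = ∑ i, f (Pi.single i 1, 0) * q.1 i + f (0, 1) * q.2 := by
    rintro ⟨q, t⟩
    have h1 : (q, t) = ∑ i, q i • ((Pi.single i 1 : ι → ℝ), (0 : ℝ)) + t • ((0 : ι → ℝ), 1) := by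
      refine Prod.ext ?_ ?_
      · ext j
        simp [Prod.fst_sum, Finset.sum_apply, Pi.single_apply]
      · simp [Prod.snd_sum]
    conv_lhs => rw [h1]
    simp only [map_add, map_sum, map_smul, smul_eq_mul, mul_comm]
  obtain ⟨q, hq, hqe⟩ := exists_mem_partitionMoments_eq_integral_maxAffine (y := y) hν
    (fun i => f (Pi.single i 1, 0)) (f (0, 1))
  have h1 := hf q (subset_closure hq)
  have h2 := h (fun i => f (Pi.single i 1, 0)) (f (0, 1))
  rw [e] at h1 hu
  dsimp only at hu
  linarith

/-- A nearby attainable pair may have wrong masses `q`. As all `p i` are positive, `p = (1 - η) q +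
η r` with `r` in the simplex; mixing in the constant partition `r` corrects the masses at a cost of
order `η`. -/
theorem exists_mem_partitionMoments_of_mem_closure (hν : MemP2 ν) {p : ι → ℝ} {v : ℝ}
    (hp : ∀ i, 0 < p i) (hp1 : ∑ i, p i = 1) (h : (p, v) ∈ closure (partitionMoments ν y))
    {ε : ℝ} (hε : 0 < ε) : ∃ v', v - ε ≤ v' ∧ (p, v') ∈ partitionMoments ν y := by
  set M : ℝ := ∑ i, |∫ x, inner ℝ (y i) x ∂ν| with hM
  have hM0 : 0 ≤ M := Finset.sum_nonneg fun i _ => abs_nonneg _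
  obtain ⟨i₀, hi₀⟩ := Finite.exists_min p
  -- The mixture loses at most `η * (|v| + 1 + M)`: `|v| + 1` bounds the nearby value `s`, and `M`
  -- the value of any constant partition.
  set η : ℝ := min (1 / 2) (ε / (2 * (|v| + 1 + M + 1))) with hη
  have hη0 : 0 < η := by positivity
  have hη1 : η ≤ 1 / 2 := min_le_left _ _
  have hη2 : η * (|v| + 1 + M + 1) ≤ ε / 2 := by
    have : η ≤ ε / (2 * (|v| + 1 + M + 1)) := min_le_right _ _
    rw [le_div_iff₀ (by positivity)] at this
    linarith
  -- Tolerance `η * p i₀`, with `p i₀` the least mass, gives `q i ≤ (1 + η) * p i`; then `r ≥ 0`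
  -- because `(1 - η) * (1 + η) ≤ 1`.
  obtain ⟨⟨q, s⟩, hq, hdist⟩ := Metric.mem_closure_iff.1 h
    (min (min 1 (ε / 2)) (η * p i₀)) (by have := hp i₀; positivity)
  simp only [Prod.dist_eq, max_lt_iff, lt_min_iff] at hdist
  obtain ⟨⟨⟨-, hd2⟩, -, hd3⟩, hd1, -⟩ := hdist
  rw [Real.dist_eq, abs_lt] at hd2 hd3
  have hqs := fst_mem_stdSimplex_of_mem_partitionMoments hν hq
  have hqle : ∀ i, q i ≤ (1 + η) * p i := fun i => by
    have h1 := (dist_le_pi_dist p q i).trans hd1.le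
    rw [Real.dist_eq, abs_le] at h1
    nlinarith [hi₀ i]
  set r : ι → ℝ := fun i => (p i - (1 - η) * q i) / η with hr
  have hrs : r ∈ stdSimplex ℝ ι := by
    refine ⟨fun i => div_nonneg ?_ hη0.le, ?_⟩
    · nlinarith [hqle i, hp i, mul_pos hη0 (mul_pos hη0 (hp i))]
    · have h2 : ∑ i, q i = 1 := hqs.2
      rw [hr, ← Finset.sum_div, Finset.sum_sub_distrib, ← Finset.mul_sum, hp1, h2]
      field_simp
      ring
  have ht : |∑ i, r i * ∫ x, inner ℝ (y i) x ∂ν| ≤ M := by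
    refine (Finset.abs_sum_le_sum_abs _ _).trans (Finset.sum_le_sum fun i _ => ?_)
    rw [abs_mul, abs_of_nonneg (hrs.1 i)]
    refine mul_le_of_le_one_left (abs_nonneg _) ?_
    rw [← hrs.2]
    exact Finset.single_le_sum (fun j _ => hrs.1 j) (Finset.mem_univ i)
  have hmem := convex_partitionMoments hν hq (const_mem_partitionMoments hν hrs)
    (sub_nonneg.2 (by linarith : η ≤ 1)) hη0.le (by ring)
  refine ⟨(1 - η) * s + η * ∑ i, r i * ∫ x, inner ℝ (y i) x ∂ν, ?_, ?_⟩
  · have h1 := neg_abs_le (∑ i, r i * ∫ x, inner ℝ (y i) x ∂ν)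
    have h2 := le_abs_self v
    nlinarith
  · convert hmem using 1
    refine Prod.ext (funext fun i => ?_) (by simp)
    simp only [hr, Prod.fst_add, Prod.smul_fst, Pi.add_apply, Pi.smul_apply, smul_eq_mul]
    field_simp
    ring

end Partition

/-! ### Passing between couplings and partition moments. -/

section Glue

variable {d : ℕ} {ι : Type*} [Fintype ι] [MeasurableSpace ι] [MeasurableSingletonClass ι]
  {μ ν ρ : Measure (EuclideanSpace ℝ (Fin d))} {y : ι → EuclideanSpace ℝ (Fin d)}
  {J : EuclideanSpace ℝ (Fin d) → ι}

/-- The coupling is `∑ i, (w i · ν) ⊗ ρ(· | J = i)`; matching masses make its second marginal `ρ`.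
-/
theorem exists_coupling_of_mem_partitionMoments (hν : MemP2 ν) (hρ : MemP2 ρ) (hJ : Measurable J)
    (hJ0 : ∀ i, 0 < ρ.real (J ⁻¹' {i})) {v : ℝ}
    (hv : ((fun i => ρ.real (J ⁻¹' {i})), v) ∈ partitionMoments ν y) :
    ∃ π ∈ couplings ν ρ, ∫ z, inner ℝ z.1 (y (J z.2)) ∂π = v := by
  have := hν.1
  have := hρ.1
  obtain ⟨w, hw, hs, hmass, hval⟩ := hv
  dsimp only at hmass hval
  have hwi : ∀ i, Measurable fun x => ENNReal.ofReal (w x i) := fun i => by fun_prop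
  have hJm : ∀ i, MeasurableSet (J ⁻¹' {i}) := fun i => hJ (measurableSet_singleton i)
  set ν' : ι → Measure (EuclideanSpace ℝ (Fin d)) :=
    fun i => ν.withDensity fun x => ENNReal.ofReal (w x i) with hν'
  set ρ' : ι → Measure (EuclideanSpace ℝ (Fin d)) :=
    fun i => ProbabilityTheory.cond ρ (J ⁻¹' {i}) with hρ'
  have hν'u : ∀ i, ν' i Set.univ = ρ (J ⁻¹' {i}) := fun i => by
    rw [hν', withDensity_apply _ MeasurableSet.univ, Measure.restrict_univ,
      ← ofReal_integral_eq_lintegral_ofReal (integrable_partition hw hs i)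
        (.of_forall fun x => (hs x).1 i), hmass, ofReal_measureReal]
  have hρ'p : ∀ i, IsProbabilityMeasure (ρ' i) := fun i =>
    ProbabilityTheory.cond_isProbabilityMeasure fun h => by simpa [Measure.real, h] using hJ0 i
  have hν'f : ∀ i, IsFiniteMeasure (ν' i) := fun i => ⟨by rw [hν'u]; exact measure_lt_top _ _⟩
  have hsum : ∑ i, ν' i = ν := by
    ext s hs'
    rw [Measure.finsetSum_apply]
    simp only [hν', withDensity_apply _ hs']
    rw [← lintegral_finsetSum _ fun i _ => hwi i]
    simp_rw [← ENNReal.ofReal_sum_of_nonneg fun i _ => (hs _).1 i, (hs _).2]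
    simp
  set π : Measure (EuclideanSpace ℝ (Fin d) × EuclideanSpace ℝ (Fin d)) :=
    ∑ i, (ν' i).prod (ρ' i) with hπ
  have hfst : π.map Prod.fst = ν := by
    rw [hπ, Measure.map_finset_sum' measurable_fst.aemeasurable]
    simpa [Measure.map_fst_prod] using hsum
  have hsnd : π.map Prod.snd = ρ := by
    rw [hπ, Measure.map_finset_sum' measurable_snd.aemeasurable]
    simp_rw [Measure.map_snd_prod, hν'u]
    exact ProbabilityTheory.sum_meas_smul_cond_fiber hJ ρ
  refine ⟨π, ⟨⟨?_⟩, hfst, hsnd⟩, ?_⟩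
  · rw [← Set.preimage_univ (f := Prod.fst), ← Measure.map_apply measurable_fst MeasurableSet.univ,
      hfst, measure_univ]
  have hae : ∀ i, (fun z : EuclideanSpace ℝ (Fin d) × EuclideanSpace ℝ (Fin d) =>
      inner ℝ z.1 (y (J z.2))) =ᵐ[(ν' i).prod (ρ' i)] fun z => inner ℝ (y i) z.1 := fun i => by
    have h1 : ∀ᵐ z ∂ρ' i, z ∈ J ⁻¹' {i} := ProbabilityTheory.ae_cond_mem (hJm i)
    filter_upwards [Measure.quasiMeasurePreserving_snd.ae h1] with z hz
    rw [Set.mem_preimage, Set.mem_singleton_iff] at hz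
    rw [hz, real_inner_comm]
  have hint : ∀ i, Integrable (fun x => inner ℝ (y i) x) (ν' i) := fun i => by
    rw [hν', integrable_withDensity_iff_integrable_smul' (hwi i) (.of_forall fun x => by simp)]
    refine (integrable_partition_mul_inner hν hw hs (y i) i).congr (.of_forall fun x => ?_)
    simp [ENNReal.toReal_ofReal ((hs x).1 i)]
  rw [hπ, integral_finsetSum_measure fun i _ => ((hint i).comp_fst _).congr (hae i).symm, ← hval]
  refine Finset.sum_congr rfl fun i _ => ?_
  rw [integral_congr_ae (hae i), integral_fun_fst (fun x => inner ℝ (y i) x), hν',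
    integral_withDensity_eq_integral_toReal_smul (hwi i) (.of_forall fun x => by simp)]
  simp [ENNReal.toReal_ofReal ((hs _).1 i)]

/-- Young's inequality with weight `η`: `|⟪x, z - ψ z⟫| ≤ η |x|² + η⁻¹ |z - ψ z|²`, and the last
term integrates to at most `η`. -/
theorem abs_integral_inner_sub_le {π : Measure (EuclideanSpace ℝ (Fin d) × EuclideanSpace ℝ (Fin d))}
    (hμ : MemP2 μ) (hρ : MemP2 ρ) (hπ : π ∈ couplings μ ρ)
    {ψ : EuclideanSpace ℝ (Fin d) → EuclideanSpace ℝ (Fin d)} (hψ : MemLp ψ 2 ρ)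
    {η : ℝ} (hη : 0 < η) (h : ∫ z, ‖z - ψ z‖ ^ 2 ∂ρ ≤ η ^ 2) :
    |∫ z, inner ℝ z.1 z.2 ∂π - ∫ z, inner ℝ z.1 (ψ z.2) ∂π| ≤ η * ((∫ x, ‖x‖ ^ 2 ∂μ) + 1) := by
  have h1 := memLp_fst_of_mem_couplings hμ hπ
  have h2 := memLp_snd_of_mem_couplings hρ hπ
  have h3 : MemLp (fun z => ψ z.2) 2 π :=
    hψ.comp_measurePreserving (measurePreserving_snd_of_mem_couplings hπ)
  have i0 : Integrable (fun z => ‖z - ψ z‖ ^ 2) ρ :=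
    (hρ.memLp_id.sub hψ).integrable_norm_pow two_ne_zero
  have i1 := h1.integrable_norm_pow two_ne_zero
  have i2 : Integrable (fun z => ‖z.2 - ψ z.2‖ ^ 2) π :=
    (h2.sub h3).integrable_norm_pow two_ne_zero
  rw [← integral_sub (integrable_inner_of_memLp_two h1 h2) (integrable_inner_of_memLp_two h1 h3),
    ← Real.norm_eq_abs]
  refine (norm_integral_le_of_norm_le ((i1.const_mul η).add (i2.const_mul η⁻¹))
    (.of_forall fun z => ?_)).trans ?_
  · rw [← inner_sub_right]
    refine (norm_inner_le_norm _ _).trans ?_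
    simp only [Pi.add_apply]
    have e : η * ‖z.1‖ ^ 2 + η⁻¹ * ‖z.2 - ψ z.2‖ ^ 2 - ‖z.1‖ * ‖z.2 - ψ z.2‖ =
        η⁻¹ * ((η * ‖z.1‖ - ‖z.2 - ψ z.2‖ / 2) ^ 2 + 3 / 4 * ‖z.2 - ψ z.2‖ ^ 2) := by
      field_simp
      ring
    have : 0 ≤ η⁻¹ * ((η * ‖z.1‖ - ‖z.2 - ψ z.2‖ / 2) ^ 2 + 3 / 4 * ‖z.2 - ψ z.2‖ ^ 2) := by
      positivity
    linarith
  · refine (integral_add (i1.const_mul η) (i2.const_mul η⁻¹)).trans_le ?_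
    rw [integral_const_mul, integral_const_mul,
      integral_fst_of_mem_couplings hπ (f := fun x => ‖x‖ ^ 2) hμ.integrable_norm_sq.1,
      integral_snd_of_mem_couplings hπ (f := fun z => ‖z - ψ z‖ ^ 2) i0.1, mul_add, mul_one]
    gcongr
    rw [inv_mul_le_iff₀ hη]
    linarith [h]

/-- The index `J z.2` is one candidate in the maximum at `z.1`; integrate this bound against `π`. -/
theorem sum_add_mul_le_integral_maxAffine [Nonempty ι]
    {π : Measure (EuclideanSpace ℝ (Fin d) × EuclideanSpace ℝ (Fin d))}
    (hμ : MemP2 μ) (hρ : MemP2 ρ) (hπ : π ∈ couplings μ ρ) (hJ : Measurable J)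
    (a : ι → ℝ) (b : ℝ) :
    ∑ i, a i * ρ.real (J ⁻¹' {i}) + b * ∫ z, inner ℝ z.1 (y (J z.2)) ∂π ≤
      ∫ x, maxAffine a (fun i => b • y i) x ∂μ := by
  have := hρ.1
  have := hπ.1
  have hyJ : MemLp (fun z : EuclideanSpace ℝ (Fin d) × EuclideanSpace ℝ (Fin d) => y (J z.2)) 2 π := by
    refine MemLp.of_bound (C := ∑ i, ‖y i‖) ?_ (.of_forall fun z => ?_)
    · exact ((measurable_of_countable y).comp (hJ.comp measurable_snd)).aestronglyMeasurable
    · exact Finset.single_le_sum (f := fun i => ‖y i‖) (fun i _ => norm_nonneg _)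
        (Finset.mem_univ _)
  have ha : Integrable (fun z => a (J z)) ρ := integrable_comp_of_finite a hJ
  have ha' : Integrable (fun z => a (J z.2)) π :=
    (measurePreserving_snd_of_mem_couplings hπ).integrable_comp_of_integrable ha
  have hb := (integrable_inner_of_memLp_two (memLp_fst_of_mem_couplings hμ hπ) hyJ).const_mul b
  have e : ∑ i, a i * ρ.real (J ⁻¹' {i}) = ∫ z, a (J z.2) ∂π := by
    rw [integral_snd_of_mem_couplings hπ (f := fun z => a (J z)) ha.1,
      ← integral_map hJ.aemeasurable (measurable_of_countable a).aestronglyMeasurable,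
      integral_fintype]
    · simp [map_measureReal_apply hJ, mul_comm]
    · exact (integrable_map_measure (measurable_of_countable a).aestronglyMeasurable
        hJ.aemeasurable).2 ha
  rw [e, ← integral_const_mul, ← integral_add ha' hb,
    ← integral_fst_of_mem_couplings hπ measurable_maxAffine.aestronglyMeasurable]
  refine integral_mono (ha'.add hb) ((measurePreserving_fst_of_mem_couplings
    hπ).integrable_comp_of_integrable (integrable_maxAffine hμ)) fun z => ?_
  refine le_trans (le_of_eq ?_) (le_maxAffine a (fun i => b • y i) (J z.2) z.1)
  rw [real_inner_smul_left, real_inner_comm]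

end Glue

/-! ### Quantization of `ρ` and the implication (i) ⇒ (ii). -/

theorem exists_finite_quantization {d : ℕ} {ρ : Measure (EuclideanSpace ℝ (Fin d))}
    (hρ : MemP2 ρ) {η : ℝ} (hη : 0 < η) :
    ∃ (S : Set (EuclideanSpace ℝ (Fin d))) (J : EuclideanSpace ℝ (Fin d) → S),
      S.Finite ∧ Measurable J ∧ (∀ i, 0 < ρ.real (J ⁻¹' {i})) ∧
      MemLp (fun z => (J z : EuclideanSpace ℝ (Fin d))) 2 ρ ∧ ∫ z, ‖z - J z‖ ^ 2 ∂ρ ≤ η ^ 2 := by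
  classical
  have := hρ.1
  obtain ⟨φ, hφ, hφL⟩ := hρ.memLp_id.exists_simpleFunc_eLpNorm_sub_lt (by simp)
    (ε := ENNReal.ofReal η) (by simpa using hη)
  -- Only atoms of positive mass are kept, since correcting the masses later requires every `p i >
  -- 0`.
  set S : Set (EuclideanSpace ℝ (Fin d)) := {y | 0 < ρ.real (φ ⁻¹' {y})} with hS
  have hSfin : S.Finite := by
    refine φ.finite_range.subset fun y hy => ?_
    by_contra hn
    have : φ ⁻¹' {y} = ∅ := Set.preimage_singleton_eq_empty.2 hn
    simp [hS, this] at hy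
  have hae : ∀ᵐ z ∂ρ, φ z ∈ S := by
    have : ∀ᵐ z ∂ρ, ∀ y ∈ φ.range, y ∉ S → φ z ≠ y := by
      refine (Filter.eventually_all_finset _).2 fun y _ => ?_
      by_cases hy : y ∈ S
      · simp [hy]
      · have h0 : ρ (φ ⁻¹' {y}) = 0 := by
          have : ρ.real (φ ⁻¹' {y}) = 0 := le_antisymm (not_lt.1 hy) measureReal_nonneg
          rwa [measureReal_eq_zero_iff] at this
        filter_upwards [measure_eq_zero_iff_ae_notMem.1 h0] with z hz _
        exact hz
    filter_upwards [this] with z hz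
    by_contra hn
    exact hz (φ z) (SimpleFunc.mem_range_self φ z) hn rfl
  obtain ⟨z₀, hz₀⟩ := hae.exists
  have hg : Measurable fun z => if φ z ∈ S then φ z else φ z₀ :=
    Measurable.ite (φ.measurableSet_preimage S) φ.measurable measurable_const
  -- The null set of discarded values is sent to the kept atom `φ z₀`.
  set J : EuclideanSpace ℝ (Fin d) → S := fun z =>
    ⟨if φ z ∈ S then φ z else φ z₀, by split_ifs with h; exacts [h, hz₀]⟩ with hJdef
  have hJφ : (fun z => (J z : EuclideanSpace ℝ (Fin d))) =ᵐ[ρ] φ := by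
    filter_upwards [hae] with z hz
    simp [hJdef, hz]
  have hJL : MemLp (fun z => (J z : EuclideanSpace ℝ (Fin d))) 2 ρ := hφL.ae_eq hJφ.symm
  refine ⟨S, J, hSfin, hg.subtype_mk, fun i => ?_, hJL, ?_⟩
  · refine lt_of_lt_of_le i.2 (measureReal_mono fun z hz => ?_)
    have hz' : φ z = i := hz
    exact Subtype.ext (by simp [hJdef, hz', i.2])
  · have h1 : eLpNorm (fun z => z - (J z : EuclideanSpace ℝ (Fin d))) 2 ρ < ENNReal.ofReal η := by
      refine lt_of_le_of_lt (le_of_eq (eLpNorm_congr_ae ?_)) hφ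
      filter_upwards [hJφ] with z hz
      simp [hz]
    have hL := hρ.memLp_id.sub hJL
    have h2 := hL.eLpNorm_eq_integral_rpow_norm (by simp) (by simp)
    have h3 : (∫ z, ‖z - (J z : EuclideanSpace ℝ (Fin d))‖ ^ 2 ∂ρ) ^ (2 : ℝ)⁻¹ < η := by
      rw [← ENNReal.ofReal_lt_ofReal_iff hη]
      refine lt_of_le_of_lt (le_of_eq ?_) h1
      refine Eq.trans ?_ h2.symm
      simp
    have h4 : 0 ≤ ∫ z, ‖z - (J z : EuclideanSpace ℝ (Fin d))‖ ^ 2 ∂ρ := by positivity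
    rw [← one_div, ← Real.sqrt_eq_rpow] at h3
    exact ((Real.sqrt_lt' hη).1 h3).le

theorem W2sq_sub_le_of_convexOrderLE {d : ℕ} {μ ν ρ : Measure (EuclideanSpace ℝ (Fin d))}
    (hμ : MemP2 μ) (hν : MemP2 ν) (hρ : MemP2 ρ) (h : ConvexOrderLE μ ν) :
    W2sq ν ρ - W2sq μ ρ ≤ (∫ x, ‖x‖ ^ 2 ∂ν) - ∫ x, ‖x‖ ^ 2 ∂μ := by
  have := hρ.1
  refine W2sq_sub_le_of_forall_exists_coupling hμ hν hρ fun π hπ ε hε => ?_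
  have hMμ : 0 ≤ ∫ x, ‖x‖ ^ 2 ∂μ := by positivity
  have hMν : 0 ≤ ∫ x, ‖x‖ ^ 2 ∂ν := by positivity
  -- `K` adds the quantization constants for `μ` and `ν`, so both errors together cost `ε / 2`;
  -- correcting the masses costs the other half.
  set K : ℝ := ((∫ x, ‖x‖ ^ 2 ∂μ) + 1) + ((∫ x, ‖x‖ ^ 2 ∂ν) + 1) with hK
  have hη : 0 < ε / (2 * K) := by positivity
  obtain ⟨S, J, hS, hJ, hJ0, hJL, hJη⟩ := exists_finite_quantization hρ hη
  have := hS.fintype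
  have : Nonempty S := ⟨J 0⟩
  have hcl := mem_closure_partitionMoments (y := fun i : S => (i : EuclideanSpace ℝ (Fin d)))
    (p := fun i => ρ.real (J ⁻¹' {i})) (v := ∫ z, inner ℝ z.1 (J z.2 : EuclideanSpace ℝ (Fin d)) ∂π)
    hν fun a b => by
      refine (sum_add_mul_le_integral_maxAffine hμ hρ hπ hJ a b).trans ?_
      have := h _ (convexOn_maxAffine (c := a) (y := fun i : S => b • (i : EuclideanSpace ℝ (Fin d))))
      rwa [eIntegral_eq_integral (integrable_maxAffine hμ),
        eIntegral_eq_integral (integrable_maxAffine hν), EReal.coe_le_coe_iff] at this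
  have hp1 : ∑ i, ρ.real (J ⁻¹' {i}) = 1 := by
    simp_rw [← map_measureReal_apply hJ (measurableSet_singleton _)]
    rw [sum_measureReal_singleton, Finset.coe_univ, map_measureReal_apply hJ MeasurableSet.univ]
    simp
  obtain ⟨v', hv', hmem⟩ := exists_mem_partitionMoments_of_mem_closure hν hJ0 hp1 hcl
    (half_pos hε)
  obtain ⟨π', hπ', hval⟩ := exists_coupling_of_mem_partitionMoments hν hρ hJ hJ0 hmem
  refine ⟨π', hπ', ?_⟩
  have h1 := (abs_le.1 (abs_integral_inner_sub_le hμ hρ hπ hJL hη hJη)).2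
  have h2 := (abs_le.1 (abs_integral_inner_sub_le hν hρ hπ' hJL hη hJη)).1
  have h3 : ε / (2 * K) * ((∫ x, ‖x‖ ^ 2 ∂μ) + 1) + ε / (2 * K) * ((∫ x, ‖x‖ ^ 2 ∂ν) + 1) =
      ε / 2 := by
    have : K ≠ 0 := by positivity
    rw [← mul_add, ← hK]
    field_simp
  linarith

/-! ### The implication (ii) ⇒ (i), by Fenchel–Young duality. -/

section Converse

variable {d : ℕ} {μ ν : Measure (EuclideanSpace ℝ (Fin d))}

theorem memP2_map_comp {ι : Type*} [Finite ι] [MeasurableSpace ι] [MeasurableSingletonClass ι]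
    (hμ : MemP2 μ) (y : ι → EuclideanSpace ℝ (Fin d)) {J : EuclideanSpace ℝ (Fin d) → ι}
    (hJ : Measurable J) : MemP2 (μ.map fun x => y (J x)) := by
  have := Fintype.ofFinite ι
  have := hμ.1
  have hm : Measurable fun x => y (J x) := (measurable_of_countable y).comp hJ
  refine ⟨Measure.isProbabilityMeasure_map hm.aemeasurable, ?_⟩
  rw [lintegral_map (by fun_prop) hm]
  calc ∫⁻ x, ‖y (J x)‖ₑ ^ 2 ∂μ ≤ ∫⁻ _, ∑ i, ‖y i‖ₑ ^ 2 ∂μ :=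
        lintegral_mono fun x => Finset.single_le_sum (f := fun i => ‖y i‖ₑ ^ 2)
          (fun _ _ => zero_le) (Finset.mem_univ (J x))
    _ < ⊤ := by
        rw [lintegral_const, measure_univ, mul_one]
        exact ENNReal.sum_lt_top.2 fun i _ => by finiteness

theorem map_prodMk_mem_couplings [IsProbabilityMeasure μ]
    {g : EuclideanSpace ℝ (Fin d) → EuclideanSpace ℝ (Fin d)} (hg : Measurable g) :
    μ.map (fun x => (x, g x)) ∈ couplings μ (μ.map g) := by
  have hm : Measurable fun x => (x, g x) := by fun_prop
  refine ⟨Measure.isProbabilityMeasure_map hm.aemeasurable, ?_, ?_⟩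
  · rw [Measure.map_map measurable_fst hm]
    exact Measure.map_id
  · rw [Measure.map_map measurable_snd hm]
    rfl

/-- A function on the slopes `y i` that dominates the convex conjugate of `maxAffine c y`. -/
theorem exists_conjugate_maxAffine {ι : Type*} [Fintype ι] [Nonempty ι] (c : ι → ℝ)
    (y : ι → EuclideanSpace ℝ (Fin d)) :
    ∃ g : EuclideanSpace ℝ (Fin d) → ℝ, Measurable g ∧
      (∀ z ∈ Set.range y, ∀ x, inner ℝ x z ≤ maxAffine c y x + g z) ∧ ∀ i, g (y i) ≤ -c i := by
  classical
  set M : ℝ := ∑ i, |c i| with hM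
  have hcM : ∀ i, -c i ≤ M := fun i => (neg_le_abs _).trans
    (Finset.single_le_sum (f := fun i => |c i|) (fun _ _ => abs_nonneg _) (Finset.mem_univ i))
  -- At a slope the infimum is the least `-c i` among indices sharing it, which handles repeated
  -- slopes; the default `M` dominates every `-c i`.
  refine ⟨Finset.univ.inf' Finset.univ_nonempty fun i z => if y i = z then -c i else M, ?_, ?_, ?_⟩
  · refine Finset.inf'_induction (p := fun f => Measurable f) _ _
      (fun f hf g hg => hf.inf hg) fun i _ => ?_
    exact Measurable.ite (measurableSet_eq_fun measurable_const measurable_id)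
      measurable_const measurable_const
  · rintro _ ⟨k, rfl⟩ x
    rw [Finset.inf'_apply, ← sub_le_iff_le_add']
    refine Finset.le_inf' _ _ fun i _ => ?_
    split_ifs with hi
    · have := le_maxAffine c y i x
      rw [← hi, real_inner_comm]
      linarith
    · have := le_maxAffine c y k x
      rw [real_inner_comm]
      linarith [hcM k]
  · intro i
    rw [Finset.inf'_apply]
    exact (Finset.inf'_le _ (Finset.mem_univ i)).trans (by simp)

/-- With `ρ` the law of the active slope, the coupling `(x, y (J x))` bounds `W2sq μ ρ` above, while
Fenchel–Young bounds `W2sq ν ρ` below; (ii) compares the two bounds. -/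
theorem integral_maxAffine_le_of_W2sq_sub_le {ι : Type*} [Fintype ι] [Nonempty ι]
    (hμ : MemP2 μ) (hν : MemP2 ν)
    (h : ∀ ρ : Measure (EuclideanSpace ℝ (Fin d)), MemP2 ρ →
      W2sq ν ρ - W2sq μ ρ ≤ (∫ x, ‖x‖ ^ 2 ∂ν) - ∫ x, ‖x‖ ^ 2 ∂μ)
    (c : ι → ℝ) (y : ι → EuclideanSpace ℝ (Fin d)) :
    ∫ x, maxAffine c y x ∂μ ≤ ∫ x, maxAffine c y x ∂ν := by
  have := hμ.1
  let _ : MeasurableSpace ι := ⊤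
  obtain ⟨J, hJ, hmax⟩ := exists_measurable_argmax_maxAffine c y
  obtain ⟨g, hg, hyoung, hgy⟩ := exists_conjugate_maxAffine c y
  have hyJ : Measurable fun x => y (J x) := (measurable_of_countable y).comp hJ
  set ρ := μ.map fun x => y (J x) with hρdef
  have hρ : MemP2 ρ := memP2_map_comp hμ y hJ
  have hcJ : Integrable (fun x => c (J x)) μ := integrable_comp_of_finite c hJ
  have hgyJ : Integrable (fun x => g (y (J x))) μ :=
    integrable_comp_of_finite (fun i => g (y i)) hJ
  have hgρ : Integrable g ρ := (integrable_map_measure hg.aestronglyMeasurable hyJ.aemeasurable).2 hgyJ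
  have hgle : ∫ z, g z ∂ρ ≤ -∫ x, c (J x) ∂μ := by
    rw [integral_map hyJ.aemeasurable hg.aestronglyMeasurable, ← integral_neg]
    exact integral_mono hgyJ hcJ.neg fun x => hgy (J x)
  have hπ₀ := map_prodMk_mem_couplings (μ := μ) hyJ
  have hup := W2sq_le hμ hρ hπ₀
  have hm : Measurable fun x => (x, y (J x)) := by fun_prop
  have hi₀ : Integrable (fun x => inner ℝ x (y (J x))) μ :=
    (integrable_map_measure (by fun_prop) hm.aemeasurable).1 (integrable_inner_of_memLp_two
      (memLp_fst_of_mem_couplings hμ hπ₀) (memLp_snd_of_mem_couplings hρ hπ₀))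
  have hval : ∫ x, maxAffine c y x ∂μ = ∫ x, c (J x) ∂μ + ∫ x, inner ℝ x (y (J x)) ∂μ := by
    rw [← integral_add hcJ hi₀]
    refine integral_congr_ae (.of_forall fun x => ?_)
    simp only [hmax x, real_inner_comm]
  rw [integral_map hm.aemeasurable (by fun_prop)] at hup
  dsimp only at hup
  have hlow : (∫ x, ‖x‖ ^ 2 ∂ν) + (∫ x, ‖x‖ ^ 2 ∂ρ) -
      2 * (∫ x, maxAffine c y x ∂ν + ∫ z, g z ∂ρ) ≤ W2sq ν ρ := by
    refine le_W2sq hν hρ fun π hπ => ?_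
    -- The Young inequality for `g` is available only on the slopes, which carry `ρ`.
    have hsupp : ∀ᵐ z ∂π, z.2 ∈ Set.range y := by
      refine (measurePreserving_snd_of_mem_couplings hπ).quasiMeasurePreserving.ae ?_
      exact (ae_map_iff hyJ.aemeasurable (Set.finite_range y).measurableSet).2
        (.of_forall fun x => ⟨J x, rfl⟩)
    have j1 := (measurePreserving_fst_of_mem_couplings hπ).integrable_comp_of_integrable
      (integrable_maxAffine (c := c) (y := y) hν)
    have j2 := (measurePreserving_snd_of_mem_couplings hπ).integrable_comp_of_integrable hgρ
    have : ∫ z, inner ℝ z.1 z.2 ∂π ≤ ∫ x, maxAffine c y x ∂ν + ∫ z, g z ∂ρ := by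
      rw [← integral_fst_of_mem_couplings hπ (integrable_maxAffine hν).1,
        ← integral_snd_of_mem_couplings hπ hgρ.1]
      refine (integral_mono_ae (integrable_inner_of_memLp_two (memLp_fst_of_mem_couplings hν hπ)
        (memLp_snd_of_mem_couplings hρ hπ)) (j1.add j2) ?_).trans_eq (integral_add j1 j2)
      filter_upwards [hsupp] with z hz
      exact hyoung _ hz _
    linarith
  linarith [h ρ hρ]

/-- Positive parts increase and negative parts decrease from an integrable one. The limiting
negative part is finite, so no `∞ - ∞` arises. -/
theorem tendsto_eIntegral_of_monotone {f : ℕ → EuclideanSpace ℝ (Fin d) → ℝ}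
    {F : EuclideanSpace ℝ (Fin d) → ℝ} (hf : ∀ n, Integrable (f n) μ)
    (hmono : ∀ x, Monotone fun n => f n x)
    (hlim : ∀ x, Filter.Tendsto (fun n => f n x) Filter.atTop (nhds (F x))) :
    Filter.Tendsto (fun n => eIntegral (f n) μ) Filter.atTop (nhds (eIntegral F μ)) := by
  have h1 : Filter.Tendsto (fun n => ∫⁻ x, ENNReal.ofReal (f n x) ∂μ) Filter.atTop
      (nhds (∫⁻ x, ENNReal.ofReal (F x) ∂μ)) :=
    lintegral_tendsto_of_tendsto_of_monotone (fun n => (hf n).1.aemeasurable.ennreal_ofReal)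
      (.of_forall fun x i j hij => ENNReal.ofReal_le_ofReal (hmono x hij))
      (.of_forall fun x => ENNReal.tendsto_ofReal (hlim x))
  have hfin : ∀ n, ∫⁻ x, ENNReal.ofReal (-f n x) ∂μ < ⊤ := fun n => (hf n).neg.lintegral_lt_top
  have h2 : Filter.Tendsto (fun n => ∫⁻ x, ENNReal.ofReal (-f n x) ∂μ) Filter.atTop
      (nhds (∫⁻ x, ENNReal.ofReal (-F x) ∂μ)) :=
    lintegral_tendsto_of_tendsto_of_antitone
      (fun n => (hf n).1.aemeasurable.neg.ennreal_ofReal)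
      (.of_forall fun x i j hij => ENNReal.ofReal_le_ofReal (neg_le_neg (hmono x hij)))
      (hfin 0).ne (.of_forall fun x => ENNReal.tendsto_ofReal (hlim x).neg)
  have hF : ∫⁻ x, ENNReal.ofReal (-F x) ∂μ < ⊤ := by
    refine (lintegral_mono fun x => ENNReal.ofReal_le_ofReal ?_).trans_lt (hfin 0)
    exact neg_le_neg ((hmono x).ge_of_tendsto (hlim x) 0)
  simp only [eIntegral, sub_eq_add_neg]
  refine (EReal.continuousAt_add (Or.inr ?_) (Or.inl (EReal.coe_ennreal_ne_bot _))).tendsto.comp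
    ((EReal.tendsto_coe_ennreal.2 h1).prodMk_nhds
      (continuous_neg.tendsto _ |>.comp (EReal.tendsto_coe_ennreal.2 h2)))
  simpa [EReal.neg_eq_bot_iff] using hF.ne

/-- A finite convex function on `ℝᵈ` is continuous, hence a countable supremum of affine functions;
take partial maxima. -/
theorem exists_tendsto_maxAffine {F : EuclideanSpace ℝ (Fin d) → ℝ}
    (hF : ConvexOn ℝ Set.univ F) :
    ∃ (c : ℕ → ℝ) (y : ℕ → EuclideanSpace ℝ (Fin d)),
      (∀ x, Monotone fun n : ℕ =>
        maxAffine (fun i : Fin (n + 1) => c i) (fun i : Fin (n + 1) => y i) x) ∧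
      ∀ x, Filter.Tendsto (fun n : ℕ =>
        maxAffine (fun i : Fin (n + 1) => c i) (fun i : Fin (n + 1) => y i) x)
        Filter.atTop (nhds (F x)) := by
  obtain ⟨l, c, hle, hsup⟩ :=
    hF.real_univ_sSup_of_nat_affine_eq hF.locallyLipschitz.continuous.lowerSemicontinuous
  set y : ℕ → EuclideanSpace ℝ (Fin d) :=
    fun n => (InnerProductSpace.toDual ℝ _).symm (l n) with hy
  have hyl : ∀ n x, inner ℝ (y n) x = l n x := fun n x => by simp [hy]
  have hmono : ∀ x, Monotone fun n : ℕ =>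
      maxAffine (fun i : Fin (n + 1) => c i) (fun i : Fin (n + 1) => y i) x :=
    fun x n m hnm => maxAffine_le fun i =>
      le_maxAffine (fun i : Fin (m + 1) => c i) (fun i : Fin (m + 1) => y i)
        (Fin.castLE (by omega) i) x
  have hleF : ∀ i x, c i + inner ℝ (y i) x ≤ F x := fun i x => by
    have := hle i x
    rw [hyl, add_comm]
    exact this
  refine ⟨c, y, hmono, fun x => tendsto_atTop_isLUB (hmono x) ⟨?_, fun t ht => ?_⟩⟩
  · rintro _ ⟨n, rfl⟩
    exact maxAffine_le fun i => hleF i x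
  · rw [← hsup, iSup_apply]
    refine ciSup_le fun i => ?_
    refine le_trans ?_ (ht ⟨i, rfl⟩)
    refine le_trans (le_of_eq ?_) (le_maxAffine (fun j : Fin (i + 1) => c j)
      (fun j : Fin (i + 1) => y j) (Fin.last i) x)
    simp [hyl, add_comm]

theorem convexOrderLE_of_W2sq_sub_le (hμ : MemP2 μ) (hν : MemP2 ν)
    (h : ∀ ρ : Measure (EuclideanSpace ℝ (Fin d)), MemP2 ρ →
      W2sq ν ρ - W2sq μ ρ ≤ (∫ x, ‖x‖ ^ 2 ∂ν) - ∫ x, ‖x‖ ^ 2 ∂μ) :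
    ConvexOrderLE μ ν := by
  intro F hF
  obtain ⟨c, y, hmono, hlim⟩ := exists_tendsto_maxAffine hF
  refine le_of_tendsto_of_tendsto'
    (tendsto_eIntegral_of_monotone (fun n => integrable_maxAffine hμ) hmono hlim)
    (tendsto_eIntegral_of_monotone (fun n => integrable_maxAffine hν) hmono hlim) fun n => ?_
  rw [eIntegral_eq_integral (integrable_maxAffine hμ),
    eIntegral_eq_integral (integrable_maxAffine hν), EReal.coe_le_coe_iff]
  exact integral_maxAffine_le_of_W2sq_sub_le hμ hν h _ _

end Converse

end ConvexOrderW2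

theorem mainTheorem1 (d : ℕ) (μ ν : Measure (EuclideanSpace ℝ (Fin d)))
    (hμ : ConvexOrderW2.MemP2 μ) (hν : ConvexOrderW2.MemP2 ν) :
    ConvexOrderW2.ConvexOrderLE μ ν ↔
      ∀ ρ : Measure (EuclideanSpace ℝ (Fin d)), ConvexOrderW2.MemP2 ρ →
        ConvexOrderW2.W2sq ν ρ - ConvexOrderW2.W2sq μ ρ ≤
          (∫ x, ‖x‖ ^ 2 ∂ν) - ∫ x, ‖x‖ ^ 2 ∂μ :=
  ⟨fun h _ hρ => ConvexOrderW2.W2sq_sub_le_of_convexOrderLE hμ hν hρ h,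
    ConvexOrderW2.convexOrderLE_of_W2sq_sub_le hμ hν⟩
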